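/- **Serializability of TxForest transactions.** *File systems and logs.* A path is a finite sequence of strings; $p/s$ extends $p$ by $s$. A file system $F$ is a partial map from paths to contents, which are $\mathsf{Dir}\,S$ ($S$ a finite set of strings) or $\mathsf{File}\,t$ ($t$ a string). It is *well-formed* if the root is a directory and $p/s\in\mathrm{dom}\,F$ iff $F(p)=\mathsf{Dir}\,S$ with $s\in S$. $\mathrm{close}(F)$ walks down from the root, keeps the contents of the nodes it meets, creates listed but missing nodes as empty files, and deletes all other paths. A log is a list of entries $\mathsf{Read}\,c\,p$, $\mathsf{WriteFile}\,c_1\,c_2\,p$, $\mathsf{WriteDir}\,c_1\,c_2\,p$ (old contents $c_1$, new contents $c_2$, written at $p$). $\mathrm{merge}(F,\lambda)$ folds over $\lambda$, replacing $F$ by $\mathrm{close}(F[p\mapsto c_2])$ for each write entry and ignoring the reads. *Programs.* Commands are $\mathsf{skip}$, sequencing, assignment, conditional, while loops and Forest commands. Forest commands navigate a zipper over a specification (file, directory, path $e::s$, dependent pair $\langle x{:}s_1,s_2\rangle$, comprehension $[s\mid x\in e]$, option $s?$, predicate $P(e)$) by Down, Up, Next, Prev, Into (pair, comprehension, option) and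 Out, or update the file system by StoreFile, StoreDir and CreatePath. Expressions are values, variables, functions, applications (values may include arbitrary pure built-in functions) and the Forest expressions Fetch (one for each kind of specification other than pairs), Run (of a navigation or a Forest expression in a local context) and Verify (the partial consistency check). The denotation $[\![c]\!]$ is a partial function that takes a local context (environment, path, zipper), a set of traversed paths and a file system to new ones together with a log, in which all reads and writes are recorded. The local small-step semantics is the standard one for imperative commands, each Forest command being one atomic step given by its denotation; each step emits its log. *Transactions.* A transaction consists of a thread (environment, local file system, path, set of traversed paths, zipper, remaining command), its full command, a start time $\tau$ and a local log $\lambda$; times are linearly ordered. It is *initial* for $F$ if its environment, set of traversed paths and log are empty, its local file system is $F$, its zipper has no parent, and its remaining command is its full command. A configuration $\langle F,K,T\rangle$ consists of a file system, a global log $K$ (a list of entries with times) and a multiset $T$ of transactions. A step of the global operational semantics picks one transaction of $T$ and does one of the following: 1. *run*: the thread makes a local step, whose log is appended to $\lambda$; 2. *commit*: if the thread is done (its remaining command is $\mathsf{skip}$) and $\mathrm{checkLog}(K,\tau,\lambda)$ holds, $F$ becomes $\mathrm{merge}(F,\lambda)$, the entries of $\lambda$ with a fresh time are appended to $K$, and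 the transaction leaves $T$; 3. *restart*: if the thread is done and $\mathrm{checkLog}(K,\tau,\lambda)$ fails, the transaction starts its full command again with the current $F$ as local file system, empty environment, path set and log, a fresh start time, and its zipper and path moved back to the root of the zipper. Here $\mathrm{checkLog}(K,\tau,\lambda)$ says that for every path $p$ that is read or written in $\lambda$, and every entry of $K$ with time $\tau'$, either $\tau'<\tau$ or the entry is not a write at $p$ or at a prefix of $p$. A fresh time is one later than all times in $K$ and all start times in $T$. *Serial semantics.* The denotation of a transaction $t$ with remaining command $c$ is the partial function $\mathcal G[\![t]\!]$ on file systems that sends $F$ to the file system component of the result of $[\![c]\!]$ in the local context and path set of $t$ and the file system $F$. For a list, $\mathcal G[\![t_1,\dots,t_n]\!](F)$ applies $\mathcal G[\![t_1]\!],\dots,\mathcal G[\![t_n]\!]$ in this order. **Theorem.** Let $F$ be a well-formed file system, $F'$ a file system, $K,K'$ global logs, and $T$ a finite multiset of transactions, each of which is initial for $F$. If $$\langle F,K,T\rangle \longrightarrow^{*} \langle F',K',\emptyset\rangle ,$$ where $\longrightarrow^{*}$ is the reflexive transitive closure of the global step relation, then there is a list $L$ that enumerates $T$ with multiplicities (a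 permutation of $T$) such that $\mathcal G[\![L]\!](F)$ is defined and $\mathcal G[\![L]\!](F)=F'$. -/

import Mathlib

universe v

namespace TxForest

noncomputable section

/-! ### Paths, file systems, logs -/

/-- A path, innermost component first: the root is `[]`, and the extension `p/s` is `s :: p`. -/
abbrev Path := List String

/-- `SubPath p q`: the path `p` lies at or below the path `q`. -/
def SubPath (p q : Path) : Prop := q <:+ p

/-- The contents of a node: a directory with the names of its children, or a file with its text. -/
inductive Contents where
  | dir (children : Finset String)
  | file (text : String)

/-- The empty file. -/
def Contents.emptyFile : Contents := .file (String.ofList [])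

/-- File systems are partial maps from paths to contents (`none` means undefined). -/
abbrev FS := Path → Option Contents

/-- A file system is well-formed if its root is a directory and a path `p/s` exists exactly when
`p` is a directory that lists `s`. -/
def FS.WellFormed (F : FS) : Prop :=
  (∃ S, F [] = some (.dir S)) ∧
    ∀ (p : Path) (s : String), (F (s :: p)).isSome ↔ ∃ S, F p = some (.dir S) ∧ s ∈ S

/-- `F[p ↦ c]`. -/
def FS.set (F : FS) (p : Path) (c : Contents) : FS := Function.update F p (some c)

/-- A path is listed if it is the root, or its parent is a listed directory of which it is a
child. -/
def FS.Listed (F : FS) : Path → Prop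
  | [] => True
  | s :: p => FS.Listed F p ∧ ∃ S, F p = some (.dir S) ∧ s ∈ S

open Classical in
/-- Closing a file system: walk down from the root, keep the contents of every node that is met,
create listed nodes that do not exist as empty files, and delete every path that is not met. -/
def FS.close (F : FS) : FS := fun p =>
  if F.Listed p then some ((F p).getD .emptyFile) else none

/-- Log entries. Old contents are optional, since a path that does not exist can be read. -/
inductive Entry where
  | read (c : Option Contents) (p : Path)
  | writeFile (old : Option Contents) (new : Contents) (p : Path)
  | writeDir (old : Option Contents) (new : Contents) (p : Path)

abbrev Log := List Entry

/-- `addNode F p s` turns `p` into a directory that contains `s`, doing the least work required;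
a missing `p` is first added to its own parent. -/
def addNode (F : FS) : Path → String → FS × Log
  | [], s =>
    match F [] with
    | none => ((F.set [] (.dir {s})).close, [.writeDir (some .emptyFile) (.dir {s}) []])
    | some (.file t) => ((F.set [] (.dir {s})).close, [.writeDir (some (.file t)) (.dir {s}) []])
    | some (.dir S) =>
      if s ∈ S then (F, [])
      else ((F.set [] (.dir (insert s S))).close,
        [.writeDir (some (.dir S)) (.dir (insert s S)) []])
  | u :: q, s =>
    match F (u :: q) with
    | none =>
      let r := addNode F q u
      ((r.1.set (u :: q) (.dir {s})).close,
        r.2 ++ [.writeDir (some .emptyFile) (.dir {s}) (u :: q)])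
    | some (.file t) =>
      ((F.set (u :: q) (.dir {s})).close,
        [.writeDir (some (.file t)) (.dir {s}) (u :: q)])
    | some (.dir S) =>
      if s ∈ S then (F, [])
      else ((F.set (u :: q) (.dir (insert s S))).close,
        [.writeDir (some (.dir S)) (.dir (insert s S)) (u :: q)])

/-- Add the path itself to its parent directory; there is nothing to add for the root. -/
def addSelf (F : FS) : Path → FS × Log
  | [] => (F, [])
  | u :: q => addNode F q u

/-- Turn the node at `p` into the file with text `s`. Undefined at the root, which has to stay a
directory. -/
def makeFile (F : FS) (p : Path) (s : String) : Option (FS × Log) :=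
  match p with
  | [] => none
  | u :: q =>
    let r := addSelf F (u :: q)
    some ((r.1.set (u :: q) (.file s)).close,
      r.2 ++ [.writeFile (r.1 (u :: q)) (.file s) (u :: q)])

/-- Turn the node at `p` into the directory with children `S`. -/
def makeDir (F : FS) (p : Path) (S : Finset String) : FS × Log :=
  let r := addSelf F p
  ((r.1.set p (.dir S)).close, r.2 ++ [.writeDir (r.1 p) (.dir S) p])

/-! ### The language -/

/-- Names of variables. -/
abbrev Var := String

/-- Forest navigations. -/
inductive Nav where
  | down | up | next | prev | intoPair | intoComp | intoOpt | out

/- Values, expressions, Forest expressions, specifications and zippers. `Fn` is the type of the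
pure built-in functions that the expression language has as values. -/
mutual

/-- Values. `ctx E p z` is a local context, `clo E x e` the closure of the function
`fun x => e`. -/
inductive Val (Fn : Type) : Type where
  | str (s : String)
  | int (n : ℤ)
  | bool (b : Bool)
  | strs (S : Finset String)
  | pair (a b : Val Fn)
  | ctx (E : Var → Option (Val Fn)) (p : Path) (z : Zipper Fn)
  | clo (E : Var → Option (Val Fn)) (x : Var) (e : Expr Fn)
  | fn (f : Fn)

/-- Expressions. -/
inductive Expr (Fn : Type) : Type where
  | forest (f : FExpr Fn)
  | val (a : Val Fn)
  | var (x : Var)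
  | app (e₁ e₂ : Expr Fn)
  | lam (x : Var) (e : Expr Fn)

/-- Forest expressions. -/
inductive FExpr (Fn : Type) : Type where
  | fetchFile | fetchDir | fetchPath | fetchComp | fetchOpt | fetchPred
  | runNav (n : Nav) (e : Expr Fn)
  | runExpr (f : FExpr Fn) (e : Expr Fn)
  | verify

/-- Specifications: `file`, `dir`, paths `e :: s`, dependent pairs `⟨x : s₁, s₂⟩`,
comprehensions `[s | x ∈ e]`, options `s?` and predicates `P(e)`. -/
inductive Spec (Fn : Type) : Type where
  | file
  | dir
  | path (e : Expr Fn) (s : Spec Fn)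
  | pair (x : Var) (s₁ s₂ : Spec Fn)
  | comp (s : Spec Fn) (x : Var) (e : Expr Fn)
  | opt (s : Spec Fn)
  | pred (e : Expr Fn)

/-- Zipper nodes: a specification with the environment in which it is read. -/
inductive Node (Fn : Type) : Type where
  | mk (E : Var → Option (Val Fn)) (s : Spec Fn)

/-- Zippers: the parent zipper, if any, the left siblings (nearest first), the node in focus, and
the right siblings (nearest first). -/
inductive Zipper (Fn : Type) : Type where
  | mk (parent : Option (Zipper Fn)) (left : List (Node Fn)) (cur : Node Fn)
      (right : List (Node Fn))

end

/-- Environments. -/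
abbrev Env (Fn : Type) := Var → Option (Val Fn)

variable {Fn : Type}

/-- `E[x ↦ a]`. -/
def Env.set (E : Env Fn) (x : Var) (a : Val Fn) : Env Fn := Function.update E x (some a)

def Zipper.parent : Zipper Fn → Option (Zipper Fn)
  | .mk a _ _ _ => a

def Zipper.cur : Zipper Fn → Node Fn
  | .mk _ _ c _ => c

/-- Is the node a path specification `e :: s`? -/
def Node.isPath : Node Fn → Bool
  | .mk _ (.path _ _) => true
  | _ => false

/-- A local context: environment, path, zipper. -/
structure Ctx (Fn : Type) : Type where
  env : Env Fn
  path : Path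
  zip : Zipper Fn

/-- A global context: the set of traversed paths, and the file system. -/
structure GCtx where
  paths : Finset Path
  fs : FS

/-- Move to the topmost ancestor of the zipper, removing the last component of the path each time
a path specification is left. -/
def gotoRoot (p : Path) : Zipper Fn → Path × Zipper Fn
  | .mk none l c r => (p, .mk none l c r)
  | .mk (some z) _ _ _ => gotoRoot (if z.cur.isPath then p.tail else p) z

/-- Results of the partial consistency check: whether the part that has been traversed is
consistent, whether it is everything, and the log. -/
abbrev Check := (Bool × Bool) × Log

/-- Conjunction of checks when the first one succeeds; when it fails, the second is not run. -/
def Check.and (a b : Check) : Check := ((a.1.1 && b.1.1, a.1.2 && b.1.2), a.2 ++ b.2)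

/-- Disjunction of checks when the first one does not succeed totally; when it does, the second is
not run. -/
def Check.or (a b : Check) : Check := ((a.1.1 || b.1.1, a.1.2 || b.1.2), a.2 ++ b.2)

/-- The elements of a set of strings, in increasing order. -/
def enum (S : Finset String) : List String := S.sort (· ≤ ·)

/- The denotations of expressions, Forest expressions, Forest navigations and the partial
consistency check are partial functions, defined as a joint least fixed point; `none` means
undefined. `prim` interprets the application of the built-in functions. -/
mutual

/-- Denotation of expressions. -/
def denExpr (prim : Fn → Val Fn → Option (Val Fn)) (e : Expr Fn) (C : Ctx Fn) (G : GCtx) :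
    Option (Val Fn × Log) :=
  match e with
  | .forest f => denForest prim f C G
  | .val a => some (a, [])
  | .var x => do
    let a ← C.env x
    pure (a, [])
  | .lam x e => some (.clo C.env x e, [])
  | .app e₁ e₂ => do
    let (a₁, l₁) ← denExpr prim e₁ C G
    let (a₂, l₂) ← denExpr prim e₂ C G
    match a₁ with
    | .fn f => do
      let b ← prim f a₂
      pure (b, l₁ ++ l₂)
    | .clo E x e => do
      let (b, l₃) ← denExpr prim e ⟨Env.set E x a₂, C.path, C.zip⟩ G
      pure (b, l₁ ++ l₂ ++ l₃)
    | _ => none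
  partial_fixpoint

/-- Denotation of Forest expressions. -/
def denForest (prim : Fn → Val Fn → Option (Val Fn)) (f : FExpr Fn) (C : Ctx Fn) (G : GCtx) :
    Option (Val Fn × Log) :=
  match f with
  | .fetchFile =>
    match C.zip.cur, G.fs C.path with
    | .mk _ .file, some (.file t) => some (.str t, [.read (some (.file t)) C.path])
    | _, _ => none
  | .fetchDir =>
    match C.zip.cur, G.fs C.path with
    | .mk _ .dir, some (.dir S) => some (.strs S, [.read (some (.dir S)) C.path])
    | _, _ => none
  | .fetchPath =>
    match C.zip.cur with
    | .mk EL (.path e _) => denExpr prim e ⟨EL, C.path, C.zip⟩ G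
    | _ => none
  | .fetchComp =>
    match C.zip.cur with
    | .mk EL (.comp _ _ e) => denExpr prim e ⟨EL, C.path, C.zip⟩ G
    | _ => none
  | .fetchOpt =>
    match C.zip.cur with
    | .mk _ (.opt _) => some (.bool (G.fs C.path).isSome, [.read (G.fs C.path) C.path])
    | _ => none
  | .fetchPred =>
    match C.zip.cur with
    | .mk EL (.pred e) => denExpr prim e ⟨EL, C.path, C.zip⟩ G
    | _ => none
  | .runNav n e => do
    let (a, l) ← denExpr prim e C G
    match a with
    | .ctx E p z => do
      let (C', _, l') ← denNav prim n ⟨E, p, z⟩ G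
      pure (.ctx C'.env C'.path C'.zip, l ++ l')
    | _ => none
  | .runExpr f e => do
    let (a, l) ← denExpr prim e C G
    match a with
    | .ctx E p z => do
      let (b, l') ← denForest prim f ⟨E, p, z⟩ G
      pure (b, l ++ l')
    | _ => none
  | .verify => do
    let r := gotoRoot C.path C.zip
    let ((b₁, b₂), l) ← pconsistent prim r.1 r.2 G
    pure (.pair (.bool b₁) (.bool b₂), l)
  partial_fixpoint

/-- Denotation of Forest navigations. -/
def denNav (prim : Fn → Val Fn → Option (Val Fn)) (n : Nav) (C : Ctx Fn) (G : GCtx) :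
    Option (Ctx Fn × GCtx × Log) :=
  match n with
  | .down =>
    match C.zip.cur with
    | .mk EL (.path e s) => do
      let (a, l) ← denExpr prim e ⟨EL, C.path, C.zip⟩ G
      match a, G.fs C.path with
      | .str u, some (.dir S) =>
        some (⟨C.env, u :: C.path, .mk (some C.zip) [] (.mk EL s) []⟩,
          ⟨insert (u :: C.path) G.paths, G.fs⟩, l ++ [.read (some (.dir S)) C.path])
      | _, _ => none
    | _ => none
  | .up =>
    match C.zip.parent with
    | some z => if z.cur.isPath then some (⟨C.env, C.path.tail, z⟩, G, []) else none
    | none => none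
  | .intoOpt =>
    match C.zip.cur with
    | .mk EL (.opt s) => some (⟨C.env, C.path, .mk (some C.zip) [] (.mk EL s) []⟩, G, [])
    | _ => none
  | .intoPair =>
    match C.zip.cur with
    | .mk EL (.pair x s₁ s₂) =>
      let a : Val Fn := .ctx EL C.path (.mk none [] (.mk EL s₁) [])
      some (⟨C.env, C.path,
        .mk (some C.zip) [] (.mk EL s₁) [.mk (Env.set EL x a) s₂]⟩, G, [])
    | _ => none
  | .intoComp =>
    match C.zip.cur with
    | .mk EL (.comp s x e) => do
      let (a, l) ← denExpr prim e ⟨EL, C.path, C.zip⟩ G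
      match a with
      | .strs S =>
        match enum S with
        | [] => none
        | h :: t =>
          let node (u : String) : Node Fn := .mk (Env.set EL x (.str u)) s
          some (⟨C.env, C.path, .mk (some C.zip) [] (node h) (t.map node)⟩, G, l)
      | _ => none
    | _ => none
  | .out =>
    match C.zip.parent with
    | some z => if z.cur.isPath then none else some (⟨C.env, C.path, z⟩, G, [])
    | none => none
  | .next =>
    match C.zip with
    | .mk (some z) l c' (c :: r) => some (⟨C.env, C.path, .mk (some z) (c' :: l) c r⟩, G, [])
    | _ => none
  | .prev =>
    match C.zip with
    | .mk (some z) (c :: l) c' r => some (⟨C.env, C.path, .mk (some z) l c (c' :: r)⟩, G, [])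
    | _ => none
  partial_fixpoint

/-- The partial consistency check of the node in focus, restricted to the traversed paths. -/
def pconsistent (prim : Fn → Val Fn → Option (Val Fn)) (p : Path) (z : Zipper Fn) (G : GCtx) :
    Option Check :=
  if p ∈ G.paths then
    match z.cur with
    | .mk _ .file =>
      let b := match G.fs p with
        | some (.file _) => true
        | _ => false
      some ((b, true), [.read (G.fs p) p])
    | .mk _ .dir =>
      let b := match G.fs p with
        | some (.dir _) => true
        | _ => false
      some ((b, true), [.read (G.fs p) p])
    | .mk E (.path e s) => do
      let (a, l) ← denExpr prim e ⟨E, p, z⟩ G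
      match a with
      | .str u =>
        match G.fs p with
        | some (.dir S) => do
          let c ← pconsistent prim (u :: p) (.mk (some z) [] (.mk E s) []) G
          pure (Check.and ((true, true), l ++ [.read (some (.dir S)) p]) c)
        | c => pure ((false, false), l ++ [.read c p])
      | _ => none
    | .mk E (.pair x s₁ s₂) => do
      let n₁ : Node Fn := .mk E s₁
      let n₂ : Node Fn := .mk (Env.set E x (.ctx E p (.mk none [] n₁ []))) s₂
      let c₁ ← pconsistent prim p (.mk (some z) [] n₁ [n₂]) G
      if c₁.1.1 then do
        let c₂ ← pconsistent prim p (.mk (some z) [n₁] n₂ []) G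
        pure (Check.and c₁ c₂)
      else pure ((false, false), c₁.2)
    | .mk E (.comp s x e) => do
      let (a, l) ← denExpr prim e ⟨E, p, z⟩ G
      match a with
      | .strs S => do
        let c ← (enum S).foldlM (fun (c₁ : Check) (u : String) =>
          if c₁.1.1 then do
            let c₂ ← pconsistent prim p
              (.mk (some z) [] (.mk (Env.set E x (.str u)) s) []) G
            pure (Check.and c₁ c₂)
          else pure ((false, false), c₁.2)) ((true, true), [])
        pure (c.1, l ++ c.2)
      | _ => none
    | .mk E (.opt s) =>
      match G.fs p with
      | none => some ((true, true), [.read none p])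
      | some k => do
        let c ← pconsistent prim p (.mk (some z) [] (.mk E s) []) G
        pure (Check.or ((false, true), [.read (some k) p]) c)
    | .mk E (.pred e) => do
      let (a, l) ← denExpr prim e ⟨E, p, z⟩ G
      match a with
      | .bool b => some ((b, true), l)
      | _ => none
  else some ((true, false), [])
  partial_fixpoint

end

/-- Forest updates. -/
inductive Update (Fn : Type) : Type where
  | storeFile (e : Expr Fn)
  | storeDir (e : Expr Fn)
  | createPath

/-- Forest commands. -/
inductive FCmd (Fn : Type) : Type where
  | nav (n : Nav)
  | update (w : Update Fn)

/-- Commands. -/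
inductive Cmd (Fn : Type) : Type where
  | forest (f : FCmd Fn)
  | skip
  | seq (c₁ c₂ : Cmd Fn)
  | assign (x : Var) (e : Expr Fn)
  | ite (e : Expr Fn) (c₁ c₂ : Cmd Fn)
  | loop (e : Expr Fn) (c : Cmd Fn)

/-- Denotation of Forest updates. -/
def denUpdate (prim : Fn → Val Fn → Option (Val Fn)) (w : Update Fn) (C : Ctx Fn) (G : GCtx) :
    Option (Ctx Fn × GCtx × Log) :=
  match w with
  | .storeFile e =>
    match C.zip.cur with
    | .mk _ .file => do
      let (a, l) ← denExpr prim e C G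
      match a with
      | .str t => do
        let (F', l') ← makeFile G.fs C.path t
        pure (C, ⟨G.paths, F'⟩, l ++ l')
      | _ => none
    | _ => none
  | .storeDir e =>
    match C.zip.cur with
    | .mk _ .dir => do
      let (a, l) ← denExpr prim e C G
      match a with
      | .strs S =>
        let r := makeDir G.fs C.path S
        pure (C, ⟨G.paths, r.1⟩, l ++ r.2)
      | _ => none
    | _ => none
  | .createPath =>
    match C.zip.cur with
    | .mk EL (.path e _) => do
      let (a, l) ← denExpr prim e ⟨EL, C.path, C.zip⟩ G
      match a with
      | .str u =>
        let r := addNode G.fs C.path u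
        pure (C, ⟨G.paths, r.1⟩, l ++ ([.read (G.fs C.path) C.path] ++ r.2))
      | _ => none
    | _ => none

/-- Denotation of Forest commands. -/
def denFCmd (prim : Fn → Val Fn → Option (Val Fn)) (f : FCmd Fn) (C : Ctx Fn) (G : GCtx) :
    Option (Ctx Fn × GCtx × Log) :=
  match f with
  | .nav n => denNav prim n C G
  | .update w => denUpdate prim w C G

/-- Denotation of commands. -/
def denCmd (prim : Fn → Val Fn → Option (Val Fn)) (c : Cmd Fn) (C : Ctx Fn) (G : GCtx) :
    Option (Ctx Fn × GCtx × Log) :=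
  match c with
  | .forest f => denFCmd prim f C G
  | .skip => some (C, G, [])
  | .seq c₁ c₂ => do
    let (C₁, G₁, l₁) ← denCmd prim c₁ C G
    let (C₂, G₂, l₂) ← denCmd prim c₂ C₁ G₁
    pure (C₂, G₂, l₁ ++ l₂)
  | .assign x e => do
    let (a, l) ← denExpr prim e C G
    pure (⟨Env.set C.env x a, C.path, C.zip⟩, G, l)
  | .ite e c₁ c₂ => do
    let (a, l) ← denExpr prim e C G
    match a with
    | .bool true => do
      let (C', G', l') ← denCmd prim c₁ C G
      pure (C', G', l ++ l')
    | .bool false => do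
      let (C', G', l') ← denCmd prim c₂ C G
      pure (C', G', l ++ l')
    | _ => none
  | .loop e c => do
    let (a, l) ← denExpr prim e C G
    match a with
    | .bool true => do
      let (C₁, G₁, l₁) ← denCmd prim c C G
      let (C₂, G₂, l₂) ← denCmd prim (.loop e c) C₁ G₁
      pure (C₂, G₂, l ++ l₁ ++ l₂)
    | .bool false => some (C, G, l)
    | _ => none
  partial_fixpoint

/-! ### Transactions -/

/-- A thread: a local context, a file system, a set of traversed paths, and the command that is
left to run. -/
structure Thread (Fn : Type) : Type where
  env : Env Fn
  fs : FS
  path : Path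
  paths : Finset Path
  zip : Zipper Fn
  cmd : Cmd Fn

/-- A transaction: a thread with the full command, the time of the start, and the local log. -/
structure Transaction (Fn : Type) (Time : Type v) : Type v where
  thread : Thread Fn
  cmd : Cmd Fn
  start : Time
  log : Log

variable {Time : Type v}

/-- Denotation of one transaction, as a partial function on file systems: the denotation of its
command in its own local context, with the given file system. -/
def denTransaction (prim : Fn → Val Fn → Option (Val Fn)) (F : FS) (t : Transaction Fn Time) :
    Option FS := do
  let (_, G, _) ← denCmd prim t.thread.cmd ⟨t.thread.env, t.thread.path, t.thread.zip⟩
    ⟨t.thread.paths, F⟩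
  pure G.fs

/-- Serial denotation of a list of transactions. -/
def denSerial (prim : Fn → Val Fn → Option (Val Fn)) (L : List (Transaction Fn Time)) (F : FS) :
    Option FS :=
  L.foldlM (denTransaction prim) F

/-- Small-step local semantics; Forest commands are atomic. -/
inductive LocalStep (prim : Fn → Val Fn → Option (Val Fn)) :
    Ctx Fn × GCtx × Cmd Fn → Log → Ctx Fn × GCtx × Cmd Fn → Prop where
  | forest {f C G C' G' l} : denFCmd prim f C G = some (C', G', l) →
      LocalStep prim (C, G, .forest f) l (C', G', .skip)
  | assign {x e C G a l} : denExpr prim e C G = some (a, l) →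
      LocalStep prim (C, G, .assign x e) l (⟨Env.set C.env x a, C.path, C.zip⟩, G, .skip)
  | seqSkip {c C G} : LocalStep prim (C, G, .seq .skip c) [] (C, G, c)
  | seqStep {c₁ c₁' c₂ C G C' G' l} : LocalStep prim (C, G, c₁) l (C', G', c₁') →
      LocalStep prim (C, G, .seq c₁ c₂) l (C', G', .seq c₁' c₂)
  | iteTrue {e c₁ c₂ C G l} : denExpr prim e C G = some (.bool true, l) →
      LocalStep prim (C, G, .ite e c₁ c₂) l (C, G, c₁)
  | iteFalse {e c₁ c₂ C G l} : denExpr prim e C G = some (.bool false, l) →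
      LocalStep prim (C, G, .ite e c₁ c₂) l (C, G, c₂)
  | loop {e c C G} :
      LocalStep prim (C, G, .loop e c) [] (C, G, .ite e (.seq c (.loop e c)) .skip)

/-- Local steps of threads. -/
def ThreadStep (prim : Fn → Val Fn → Option (Val Fn)) (t : Thread Fn) (l : Log) (t' : Thread Fn) :
    Prop :=
  LocalStep prim (⟨t.env, t.path, t.zip⟩, ⟨t.paths, t.fs⟩, t.cmd) l
    (⟨t'.env, t'.path, t'.zip⟩, ⟨t'.paths, t'.fs⟩, t'.cmd)

/-- A thread is done when nothing is left to run. -/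
def Thread.IsDone (t : Thread Fn) : Prop := t.cmd = .skip

/-- The effect of a log entry on a file system. -/
def FS.update (F : FS) : Entry → FS
  | .read _ _ => F
  | .writeFile _ c p => (F.set p c).close
  | .writeDir _ c p => (F.set p c).close

/-- Merge a log into a file system. -/
def FS.merge (F : FS) (l : Log) : FS := l.foldl FS.update F

/-- The paths that are read or written in a log. -/
def extractPaths : Log → Set Path
  | [] => ∅
  | .read _ p :: l => {p} ∪ extractPaths l
  | .writeFile _ _ p :: l => {p} ∪ extractPaths l
  | .writeDir _ _ p :: l => {p} ∪ extractPaths l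

/-- A path conflicts with a write at or above it. -/
def ConflictPath (p : Path) : Entry → Prop
  | .read _ _ => False
  | .writeFile _ _ q => SubPath p q
  | .writeDir _ _ q => SubPath p q

/-- Timestamped logs. -/
abbrev GLog (Time : Type v) := List (Time × Entry)

/-- Add one timestamp to all entries of a log. -/
def addTimestamp (τ : Time) (l : Log) : GLog Time := l.map fun k => (τ, k)

/-- No path of the log `l` conflicts with an entry of the global log from time `τ` on. -/
def CheckLog [LinearOrder Time] (K : GLog Time) (τ : Time) (l : Log) : Prop :=
  ∀ p ∈ extractPaths l, ∀ k ∈ K, k.1 < τ ∨ ¬ ConflictPath p k.2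

/-- A global configuration: file system, global log, thread pool. -/
structure Config (Fn : Type) (Time : Type v) : Type v where
  fs : FS
  glog : GLog Time
  pool : Multiset (Transaction Fn Time)

/-- A fresh timestamp is later than every timestamp in the configuration. -/
def Config.Fresh [LinearOrder Time] (S : Config Fn Time) (τ : Time) : Prop :=
  (∀ k ∈ S.glog, k.1 < τ) ∧ ∀ t ∈ S.pool, t.start < τ

/-- The transaction that runs the command `c` from the start: empty environment, no traversed
paths, empty log. -/
def startTransaction (F : FS) (p : Path) (z : Zipper Fn) (c : Cmd Fn) (τ : Time) :
    Transaction Fn Time :=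
  ⟨⟨fun _ => none, F, p, ∅, z, c⟩, c, τ, []⟩

/-- An initial transaction with respect to a file system: it has not run yet, its local file
system is the given one, and its zipper is at a root. -/
def Initial (F : FS) (t : Transaction Fn Time) : Prop :=
  ∃ p z c τ, z.parent = none ∧ t = startTransaction F p z c τ

/-- Global steps: a local step, a commit, or a restart of one transaction in the pool. -/
inductive GlobalStep [LinearOrder Time] (prim : Fn → Val Fn → Option (Val Fn)) :
    Config Fn Time → Config Fn Time → Prop where
  | run {F K T c τ l l'} {t t' : Thread Fn} : ThreadStep prim t l' t' →
      GlobalStep prim ⟨F, K, ⟨t, c, τ, l⟩ ::ₘ T⟩ ⟨F, K, ⟨t', c, τ, l ++ l'⟩ ::ₘ T⟩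
  | commit {F K T c τ l τ'} {t : Thread Fn} : t.IsDone → CheckLog K τ l →
      Config.Fresh ⟨F, K, ⟨t, c, τ, l⟩ ::ₘ T⟩ τ' →
      GlobalStep prim ⟨F, K, ⟨t, c, τ, l⟩ ::ₘ T⟩ ⟨F.merge l, K ++ addTimestamp τ' l, T⟩
  | restart {F K T c τ l τ'} {t : Thread Fn} : t.IsDone → ¬ CheckLog K τ l →
      Config.Fresh ⟨F, K, ⟨t, c, τ, l⟩ ::ₘ T⟩ τ' →
      GlobalStep prim ⟨F, K, ⟨t, c, τ, l⟩ ::ₘ T⟩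
        ⟨F, K, startTransaction F (gotoRoot t.path t.zip).1 (gotoRoot t.path t.zip).2 c τ' ::ₘ T⟩

end

end TxForest

namespace TxForest

variable {Fn : Type} {Time : Type v}

/-! ### Logs and merging -/

-- The serial order is the order of the commits; it remains to see that a committing transaction has
-- the effect of running from the start, alone, on the file system present at that moment.
--
-- The key is that the log determines a run. Expressions and navigations write nothing and depend
-- only on the paths they log (`den_replays`). A command turns its file system into the merge of its
-- own log, and gives the same log on every file system that agrees with the first on a
-- prefix-closed set containing the logged paths (`denCmd_tracks`). Prefixes are needed because
-- adding a node inspects ancestors it may not log, and because closing at a path looks at all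
-- ancestors.
--
-- The paths on which no write since the start time `τ` has an effect form a prefix-closed set,
-- `unaffected K τ`, and `CheckLog` says exactly that the logged paths lie in it. Throughout the
-- execution, each pool member is paired with its original transaction by the invariant `Runs`: the
-- run so far, continued by whatever remains, is a run of the full command on a file system `Fs`
-- that agrees with the present one on the unaffected paths. Local steps preserve this by
-- `denCmd_of_localStep`. A commit elsewhere preserves it because a merge into a well-formed file
-- system changes only paths at or below its writes (`FS.WellFormed.merge_apply`), and the fresh
-- timestamp removes these from the unaffected set. A restart reestablishes it with `Fs` the present
-- file system, since `gotoRoot` is invariant under local steps and so recovers the initial path and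
-- zipper. When a transaction commits, its run transfers from `Fs` to the present file system, with
-- the same log.

@[simp]
theorem extractPaths_nil : extractPaths [] = ∅ := rfl

theorem extractPaths_append (l l' : Log) :
    extractPaths (l ++ l') = extractPaths l ∪ extractPaths l' := by
  induction l with
  | nil => simp
  | cons k l ih => cases k <;> simp [extractPaths, ih, Set.insert_union]

/-- A log without writes. -/
def ReadOnly (l : Log) : Prop := ∀ k ∈ l, ∃ c p, k = .read c p

@[simp]
theorem readOnly_nil : ReadOnly [] := by simp [ReadOnly]

@[simp]
theorem readOnly_read (c : Option Contents) (p : Path) : ReadOnly [.read c p] := by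
  simp [ReadOnly]

@[simp]
theorem readOnly_read_cons (c : Option Contents) (p : Path) (l : Log) :
    ReadOnly (.read c p :: l) ↔ ReadOnly l := by
  simp [ReadOnly]

@[simp]
theorem readOnly_append {l l' : Log} : ReadOnly (l ++ l') ↔ ReadOnly l ∧ ReadOnly l' := by
  simp [ReadOnly, or_imp, forall_and]

@[simp]
theorem FS.merge_nil (F : FS) : F.merge [] = F := rfl

theorem FS.merge_append (F : FS) (l l' : Log) : F.merge (l ++ l') = (F.merge l).merge l' := by
  simp [FS.merge, List.foldl_append]

theorem ReadOnly.merge {l : Log} (hl : ReadOnly l) (F : FS) : F.merge l = F := by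
  induction l with
  | nil => rfl
  | cons k l ih =>
    obtain ⟨c, p, rfl⟩ := hl k (by simp)
    exact ih fun k hk => hl k (by simp [hk])

/-- Every write at the root makes the root a directory. -/
def RootDir : Entry → Prop
  | .read _ _ => True
  | .writeFile _ c p => p = [] → ∃ S, c = .dir S
  | .writeDir _ c p => p = [] → ∃ S, c = .dir S

theorem ReadOnly.rootDir {l : Log} (hl : ReadOnly l) : ∀ k ∈ l, RootDir k := by
  intro k hk
  obtain ⟨c, p, rfl⟩ := hl k hk
  trivial

/-! ### Closing a file system -/

theorem FS.listed_congr {F F' : FS} {p : Path}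
    (h : ∀ q, q <:+ p → q ≠ p → F q = F' q) : F.Listed p ↔ F'.Listed p := by
  induction p with
  | nil => simp [FS.Listed]
  | cons s p ih =>
    have hne : p ≠ s :: p := fun e => by simpa using congrArg List.length e
    rw [FS.Listed, FS.Listed, h p (List.suffix_cons s p) hne, ih fun q hq hqp =>
      h q (hq.trans (List.suffix_cons s p)) fun e => by
        subst e; simpa using hq.length_le]

/-- Whether the walk from the root meets `p` is decided by the proper prefixes of `p`, so closing is
local to prefixes. -/
theorem FS.close_congr {F F' : FS} {p : Path} (h : ∀ q, q <:+ p → F q = F' q) :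
    F.close p = F'.close p := by
  have : F.Listed p ↔ F'.Listed p := FS.listed_congr fun q hq _ => h q hq
  by_cases hp : F.Listed p
  · simp [FS.close, hp, this.1 hp, h p List.suffix_rfl]
  · simp [FS.close, hp, mt this.2 hp]

theorem FS.WellFormed.listed_iff {F : FS} (hF : F.WellFormed) (p : Path) :
    F.Listed p ↔ (F p).isSome := by
  cases p with
  | nil => obtain ⟨S, hS⟩ := hF.1; simp [FS.Listed, hS]
  | cons s p =>
    rw [FS.Listed, hF.2, hF.listed_iff p]
    exact ⟨fun h => h.2, fun h => ⟨by obtain ⟨S, hS, -⟩ := h; simp [hS], h⟩⟩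

theorem FS.WellFormed.close_eq {F : FS} (hF : F.WellFormed) : F.close = F := by
  funext p
  rw [FS.close]
  split_ifs with h
  · rw [hF.listed_iff, Option.isSome_iff_exists] at h
    obtain ⟨c, hc⟩ := h
    simp [hc]
  · rw [hF.listed_iff] at h
    exact (Option.not_isSome_iff_eq_none.1 h).symm

/-- Nodes created by closing are files, so closing never produces a new directory. Hence a single
pass yields a well-formed file system, provided the root is a directory. -/
theorem FS.close_eq_dir {F : FS} {p : Path} {S : Finset String} :
    F.close p = some (.dir S) ↔ F.Listed p ∧ F p = some (.dir S) := by
  rw [FS.close]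
  split_ifs with h
  · cases hp : F p <;> simp [h, Contents.emptyFile]
  · simp [h]

theorem FS.wellFormed_close {F : FS} (h : ∃ S, F [] = some (.dir S)) : F.close.WellFormed := by
  refine ⟨h.imp fun S hS => FS.close_eq_dir.2 ⟨trivial, hS⟩, fun p s => ?_⟩
  have : (F.close (s :: p)).isSome ↔ F.Listed (s :: p) := by
    rw [FS.close]; split_ifs with h <;> simp [h]
  rw [this, FS.Listed]
  simp only [FS.close_eq_dir]
  tauto

theorem FS.WellFormed.set_close {F : FS} (hF : F.WellFormed) {p : Path} {c : Contents}
    (h : p = [] → ∃ S, c = .dir S) : (F.set p c).close.WellFormed := by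
  apply FS.wellFormed_close
  by_cases hp : p = []
  · obtain ⟨S, rfl⟩ := h hp
    exact ⟨S, by simp [FS.set, hp]⟩
  · simpa [FS.set, Function.update_of_ne (Ne.symm hp)] using hF.1

theorem FS.WellFormed.merge {F : FS} (hF : F.WellFormed) {l : Log} (hl : ∀ k ∈ l, RootDir k) :
    (F.merge l).WellFormed := by
  induction l generalizing F with
  | nil => exact hF
  | cons k l ih =>
    refine ih (F := F.update k) ?_ fun k hk => hl k (by simp [hk])
    have hk := hl k (by simp)
    cases k with
    | read c p => exact hF
    | writeFile c c' p => exact hF.set_close hk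
    | writeDir c c' p => exact hF.set_close hk

/-! ### Agreement of file systems on a set of paths -/

/-- A set of paths that contains all prefixes of its elements. -/
def PrefixClosed (P : Set Path) : Prop := ∀ p ∈ P, ∀ q, q <:+ p → q ∈ P

theorem FS.set_eqOn {P : Set Path} {F F' : FS} (h : P.EqOn F F') (p : Path) (c : Contents) :
    P.EqOn (F.set p c) (F'.set p c) := by
  intro q hq
  by_cases hqp : q = p
  · simp [FS.set, hqp]
  · simpa [FS.set, Function.update_of_ne hqp] using h hq

theorem FS.close_eqOn {P : Set Path} (hP : PrefixClosed P) {F F' : FS} (h : P.EqOn F F') :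
    P.EqOn F.close F'.close :=
  fun p hp => FS.close_congr fun q hq => h (hP p hp q hq)

theorem FS.merge_eqOn {P : Set Path} (hP : PrefixClosed P) {F F' : FS} (h : P.EqOn F F')
    (l : Log) : P.EqOn (F.merge l) (F'.merge l) := by
  induction l generalizing F F' with
  | nil => exact h
  | cons k l ih =>
    refine ih (F := F.update k) (F' := F'.update k) ?_
    cases k with
    | read c p => exact h
    | writeFile c c' p => exact FS.close_eqOn hP (FS.set_eqOn h p c')
    | writeDir c c' p => exact FS.close_eqOn hP (FS.set_eqOn h p c')

/-- Closing fixes a well-formed `F`, so `F q` can be read as `F.close q`; no prefix of `q` is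
changed by a write at `p` unless `p` is itself such a prefix. In particular writes strictly below
`q` leave `q` alone, which is why conflicts are only sought at or above a path. -/
theorem FS.WellFormed.set_close_apply {F : FS} (hF : F.WellFormed) {p q : Path} (c : Contents)
    (h : ¬ SubPath q p) : (F.set p c).close q = F q := by
  conv_rhs => rw [← hF.close_eq]
  refine FS.close_congr fun r hr => ?_
  have : r ≠ p := fun e => h (e ▸ hr)
  simp [FS.set, Function.update_of_ne this]

theorem FS.WellFormed.merge_apply {F : FS} (hF : F.WellFormed) {l : Log}
    (hl : ∀ k ∈ l, RootDir k) {p : Path} (hp : ∀ k ∈ l, ¬ ConflictPath p k) :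
    F.merge l p = F p := by
  induction l generalizing F with
  | nil => rfl
  | cons k l ih =>
    have hk := hl k (by simp)
    have hpk := hp k (by simp)
    have hF' : (F.update k).WellFormed := hF.merge (l := [k]) (by simpa using hk)
    refine (ih hF' (fun k hk => hl k (by simp [hk])) fun k hk => hp k (by simp [hk])).trans ?_
    cases k with
    | read c q => rfl
    | writeFile c c' q => exact hF.set_close_apply c' hpk
    | writeDir c c' q => exact hF.set_close_apply c' hpk

/-! ### Expressions and navigations read only what they log -/

/-- `Replays F l x r`: the run `x`, parametrized by the file system, gives the result `r` on every
file system that agrees with `F` on the paths that are logged in `l`, and `l` has no writes. -/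
def Replays {α : Type} (F : FS) (l : Log) (x : FS → Option α) (r : FS → α) : Prop :=
  ReadOnly l ∧ ∀ F' : FS, (extractPaths l).EqOn F F' → x F' = some (r F')

/-- Serves the comprehension case of the consistency check. The accumulator carries the log so far,
so the claim concerns only the part `l` that the fold adds. Here `f` stands for the body run with a
fixpoint approximation, and `g` for the true body with a variable file system. -/
theorem foldlM_check_replays {F : FS} {f : Check → String → Option Check}
    {g : FS → Check → String → Option Check}
    (hfg : ∀ c u c', f c u = some c' → ∃ l, c'.2 = c.2 ++ l ∧
      Replays F l (fun F' => g F' c u) fun _ => c')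
    (L : List String) (c c' : Check) (h : L.foldlM f c = some c') :
    ∃ l, c'.2 = c.2 ++ l ∧ Replays F l (fun F' => L.foldlM (g F') c) fun _ => c' := by
  induction L generalizing c with
  | nil =>
    simp only [List.foldlM_nil, Option.pure_def, Option.some.injEq] at h
    exact ⟨[], by simp [h], by simp [Replays, h]⟩
  | cons u L ih =>
    simp only [List.foldlM_cons, Option.bind_eq_bind, Option.bind_eq_some_iff] at h
    obtain ⟨d, hd, h⟩ := h
    obtain ⟨l, hl, hr, hx⟩ := hfg c u d hd
    obtain ⟨l', hl', hr', hx'⟩ := ih d h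
    refine ⟨l ++ l', by simp [hl', hl], by simp [hr, hr'], fun F' hF' => ?_⟩
    rw [extractPaths_append, Set.eqOn_union] at hF'
    have h1 := hx F' hF'.1
    have h2 := hx' F' hF'.2
    dsimp only at h1 h2
    simp [List.foldlM_cons, h1, h2]

/-- Joint fixpoint induction: every inspection of the file system is logged, and the logs of
subcomputations are concatenated, so agreement on the whole log gives agreement on each part.
Navigations also preserve `gotoRoot`, because a path component is added or removed exactly when a
path specification is entered or left. -/
theorem den_replays (prim : Fn → Val Fn → Option (Val Fn)) (G : GCtx) :
    (∀ (e : Expr Fn) (C : Ctx Fn) r, denExpr prim e C G = some r →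
      Replays G.fs r.2 (fun F => denExpr prim e C ⟨G.paths, F⟩) fun _ => r) ∧
    (∀ (f : FExpr Fn) (C : Ctx Fn) r, denForest prim f C G = some r →
      Replays G.fs r.2 (fun F => denForest prim f C ⟨G.paths, F⟩) fun _ => r) ∧
    (∀ (p : Path) (z : Zipper Fn) r, pconsistent prim p z G = some r →
      Replays G.fs r.2 (fun F => pconsistent prim p z ⟨G.paths, F⟩) fun _ => r) ∧
    (∀ (n : Nav) (C : Ctx Fn) r, denNav prim n C G = some r →
      (r.2.1.fs = G.fs ∧ gotoRoot r.1.path r.1.zip = gotoRoot C.path C.zip) ∧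
      Replays G.fs r.2.2 (fun F => denNav prim n C ⟨G.paths, F⟩)
        fun F => (r.1, ⟨r.2.1.paths, F⟩, r.2.2)) := by
  apply denExpr.mutual_partial_correctness
  · intro dE dF hE hF e C r h
    split at h
    · obtain ⟨h1, h2⟩ := hF _ _ _ h
      refine ⟨h1, fun F' hF' => ?_⟩
      beta_reduce
      rw [denExpr]
      exact h2 F' hF'
    · cases h
      simp [Replays, denExpr]
    · simp [Option.bind_eq_some_iff] at h
      obtain ⟨a, ha, rfl⟩ := h
      simp [Replays, denExpr, ha]
    · cases h
      simp [Replays, denExpr]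
    · simp only [Option.bind_eq_bind, Option.bind_eq_some_iff] at h
      obtain ⟨⟨a₁, l₁⟩, h₁, ⟨a₂, l₂⟩, h₂, h⟩ := h
      obtain ⟨r₁, x₁⟩ := hE _ _ _ h₁
      obtain ⟨r₂, x₂⟩ := hE _ _ _ h₂
      simp only at r₁ x₁ r₂ x₂ h
      split at h
      · simp [Option.bind_eq_some_iff] at h
        obtain ⟨b, hb, rfl⟩ := h
        refine ⟨by simp [r₁, r₂], fun F' hF' => ?_⟩
        simp only [extractPaths_append, Set.eqOn_union] at hF'
        beta_reduce
        rw [denExpr]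
        simp [x₁ F' hF'.1, x₂ F' hF'.2, hb]
      · simp only [Option.bind_eq_some_iff] at h
        obtain ⟨⟨b, l₃⟩, h₃, h⟩ := h
        obtain ⟨r₃, x₃⟩ := hE _ _ _ h₃
        cases h
        refine ⟨by simp [r₁, r₂, r₃], fun F' hF' => ?_⟩
        simp only [extractPaths_append, Set.eqOn_union] at hF'
        beta_reduce
        rw [denExpr]
        simp [x₁ F' hF'.1.1, x₂ F' hF'.1.2, x₃ F' hF'.2]
      · cases h
  · intro dE dF dP dN hE hF hP hN f C r h
    split at h
    · split at h
      · rename_i hc hf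
        cases h
        refine ⟨by simp, fun F' hF' => ?_⟩
        have := hF' (x := C.path) (by simp [extractPaths])
        beta_reduce
        rw [denForest]
        simp [hc, ← this, hf]
      · cases h
    · split at h
      · rename_i hc hf
        cases h
        refine ⟨by simp, fun F' hF' => ?_⟩
        have := hF' (x := C.path) (by simp [extractPaths])
        beta_reduce
        rw [denForest]
        simp [hc, ← this, hf]
      · cases h
    · split at h
      · rename_i hc
        obtain ⟨h1, h2⟩ := hE _ _ _ h
        refine ⟨h1, fun F' hF' => ?_⟩
        beta_reduce
        rw [denForest]
        simp [hc, h2 F' hF']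
      · cases h
    · split at h
      · rename_i hc
        obtain ⟨h1, h2⟩ := hE _ _ _ h
        refine ⟨h1, fun F' hF' => ?_⟩
        beta_reduce
        rw [denForest]
        simp [hc, h2 F' hF']
      · cases h
    · split at h
      · rename_i hc
        cases h
        refine ⟨by simp, fun F' hF' => ?_⟩
        have := hF' (x := C.path) (by simp [extractPaths])
        beta_reduce
        rw [denForest]
        simp [hc, ← this]
      · cases h
    · split at h
      · rename_i hc
        obtain ⟨h1, h2⟩ := hE _ _ _ h
        refine ⟨h1, fun F' hF' => ?_⟩
        beta_reduce
        rw [denForest]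
        simp [hc, h2 F' hF']
      · cases h
    · simp only [Option.bind_eq_bind, Option.bind_eq_some_iff] at h
      obtain ⟨⟨a, l⟩, h₁, h⟩ := h
      obtain ⟨r₁, x₁⟩ := hE _ _ _ h₁
      simp only at r₁ x₁ h
      split at h
      · simp only [Option.bind_eq_some_iff] at h
        obtain ⟨⟨C', G', l'⟩, h₂, h⟩ := h
        obtain ⟨-, r₂, x₂⟩ := hN _ _ _ h₂
        cases h
        refine ⟨by simp_all, fun F' hF' => ?_⟩
        simp only [extractPaths_append, Set.eqOn_union] at hF'
        beta_reduce
        rw [denForest]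
        simp [x₁ F' hF'.1, x₂ F' hF'.2]
      · cases h
    · simp only [Option.bind_eq_bind, Option.bind_eq_some_iff] at h
      obtain ⟨⟨a, l⟩, h₁, h⟩ := h
      obtain ⟨r₁, x₁⟩ := hE _ _ _ h₁
      simp only at r₁ x₁ h
      split at h
      · simp only [Option.bind_eq_some_iff] at h
        obtain ⟨⟨b, l'⟩, h₂, h⟩ := h
        obtain ⟨r₂, x₂⟩ := hF _ _ _ h₂
        cases h
        refine ⟨by simp_all, fun F' hF' => ?_⟩
        simp only [extractPaths_append, Set.eqOn_union] at hF'
        beta_reduce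
        rw [denForest]
        simp [x₁ F' hF'.1, x₂ F' hF'.2]
      · cases h
    · simp only [Option.bind_eq_bind, Option.bind_eq_some_iff] at h
      obtain ⟨⟨⟨b₁, b₂⟩, l⟩, h₁, h⟩ := h
      obtain ⟨r₁, x₁⟩ := hP _ _ _ h₁
      cases h
      refine ⟨r₁, fun F' hF' => ?_⟩
      beta_reduce
      rw [denForest]
      simp [x₁ F' hF']
  · intro dE dP hE hP p z r h
    split at h
    · rename_i hp
      split at h
      · rename_i hc
        cases h
        refine ⟨by simp, fun F' hF' => ?_⟩
        have := hF' (x := p) (by simp [extractPaths])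
        beta_reduce
        rw [pconsistent]
        simp [hp, hc, ← this]
      · rename_i hc
        cases h
        refine ⟨by simp, fun F' hF' => ?_⟩
        have := hF' (x := p) (by simp [extractPaths])
        beta_reduce
        rw [pconsistent]
        simp [hp, hc, ← this]
      · rename_i hc
        simp only [Option.bind_eq_bind, Option.bind_eq_some_iff] at h
        obtain ⟨⟨a, l⟩, h₁, h⟩ := h
        obtain ⟨r₁, x₁⟩ := hE _ _ _ h₁
        simp only at r₁ x₁ h
        split at h
        · split at h
          · rename_i hf
            simp only [Option.bind_eq_some_iff] at h
            obtain ⟨c, h₂, h⟩ := h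
            obtain ⟨r₂, x₂⟩ := hP _ _ _ h₂
            cases h
            refine ⟨by simp [Check.and, r₁, r₂], fun F' hF' => ?_⟩
            simp only [Check.and, extractPaths_append, Set.eqOn_union] at hF'
            have := hF'.1.2 (x := p) (by simp [extractPaths])
            beta_reduce
            rw [pconsistent]
            simp [hp, hc, x₁ F' hF'.1.1, ← this, hf, x₂ F' hF'.2]
          · rename_i hf
            cases h
            refine ⟨by simp [r₁], fun F' hF' => ?_⟩
            simp only [extractPaths_append, Set.eqOn_union] at hF'
            have := hF'.2 (x := p) (by simp [extractPaths])
            beta_reduce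
            rw [pconsistent]
            simp only [hp, if_true, hc, x₁ F' hF'.1, ← this, Option.bind_eq_bind,
              Option.bind_some, Option.pure_def]
        · cases h
      · rename_i hc
        simp only [Option.bind_eq_bind, Option.bind_eq_some_iff] at h
        obtain ⟨c₁, h₁, h⟩ := h
        obtain ⟨r₁, x₁⟩ := hP _ _ _ h₁
        split_ifs at h with hb
        · simp only [Option.bind_eq_some_iff] at h
          obtain ⟨c₂, h₂, h⟩ := h
          obtain ⟨r₂, x₂⟩ := hP _ _ _ h₂
          cases h
          refine ⟨by simp [Check.and, r₁, r₂], fun F' hF' => ?_⟩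
          simp only [Check.and, extractPaths_append, Set.eqOn_union] at hF'
          beta_reduce
          rw [pconsistent]
          simp [hp, hc, x₁ F' hF'.1, x₂ F' hF'.2, hb]
        · cases h
          refine ⟨r₁, fun F' hF' => ?_⟩
          beta_reduce
          rw [pconsistent]
          simp [hp, hc, x₁ F' hF', hb]
      · rename_i E s x e hc
        simp only [Option.bind_eq_bind, Option.bind_eq_some_iff] at h
        obtain ⟨⟨a, l⟩, h₁, h⟩ := h
        obtain ⟨r₁, x₁⟩ := hE _ _ _ h₁
        simp only at r₁ x₁ h
        split at h
        · simp only [Option.bind_eq_some_iff] at h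
          obtain ⟨c, h₂, h⟩ := h
          cases h
          -- Each round adds the log of the element's check, or nothing once an earlier element has
          -- failed.
          obtain ⟨l', hl', r₂, x₂⟩ := foldlM_check_replays (F := G.fs)
            (g := fun F' (c₁ : Check) (u : String) =>
              if c₁.1.1 then
                (pconsistent prim p (.mk (some z) [] (.mk (Env.set E x (.str u)) s) [])
                  ⟨G.paths, F'⟩).bind fun c₂ => pure (Check.and c₁ c₂)
              else pure ((false, false), c₁.2)) (by
              intro c u c' hcu
              split_ifs at hcu with hb
              · simp only [Option.bind_eq_some_iff] at hcu
                obtain ⟨c₂, h₂, hcu⟩ := hcu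
                obtain ⟨r₂, x₂⟩ := hP _ _ _ h₂
                cases hcu
                refine ⟨c₂.2, rfl, r₂, fun F' hF' => ?_⟩
                simp [hb, x₂ F' hF']
              · cases hcu
                exact ⟨[], by simp [Replays, hb]⟩) _ _ _ h₂
          simp only [List.nil_append] at hl'
          subst hl'
          refine ⟨by simp [r₁, r₂], fun F' hF' => ?_⟩
          simp only [extractPaths_append, Set.eqOn_union] at hF'
          beta_reduce
          rw [pconsistent]
          have := x₂ F' hF'.2
          simp only at this
          simp [hp, hc, x₁ F' hF'.1]
          simp at this
          rw [this]
          rfl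
        · cases h
      · rename_i hc
        split at h
        · rename_i hf
          cases h
          refine ⟨by simp, fun F' hF' => ?_⟩
          have := hF' (x := p) (by simp [extractPaths])
          beta_reduce
          rw [pconsistent]
          simp [hp, hc, ← this, hf]
        · rename_i hf
          simp only [Option.bind_eq_bind, Option.bind_eq_some_iff] at h
          obtain ⟨c, h₂, h⟩ := h
          obtain ⟨r₂, x₂⟩ := hP _ _ _ h₂
          cases h
          refine ⟨by simp only [Check.or, readOnly_append, readOnly_read, r₂, and_self],
            fun F' hF' => ?_⟩
          simp only [Check.or, extractPaths_append, Set.eqOn_union] at hF'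
          have := hF'.1 (x := p) (by simp [extractPaths])
          beta_reduce
          rw [pconsistent]
          simp [hp, hc, ← this, hf, x₂ F' hF'.2]
      · rename_i hc
        simp only [Option.bind_eq_bind, Option.bind_eq_some_iff] at h
        obtain ⟨⟨a, l⟩, h₁, h⟩ := h
        obtain ⟨r₁, x₁⟩ := hE _ _ _ h₁
        simp only at r₁ x₁ h
        split at h
        · cases h
          refine ⟨r₁, fun F' hF' => ?_⟩
          beta_reduce
          rw [pconsistent]
          simp [hp, hc, x₁ F' hF']
        · cases h
    · rename_i hp
      cases h
      refine ⟨by simp, fun F' hF' => ?_⟩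
      beta_reduce
      rw [pconsistent]
      simp [hp]
  · intro dE hE n C r h
    obtain ⟨env, path, ⟨par, left, cur, right⟩⟩ := C
    split at h
    · split at h
      · rename_i hc
        simp only [Option.bind_eq_bind, Option.bind_eq_some_iff] at h
        obtain ⟨⟨a, l⟩, h₁, h⟩ := h
        obtain ⟨r₁, x₁⟩ := hE _ _ _ h₁
        simp only at r₁ x₁ h
        split at h
        · rename_i hf
          cases h
          refine ⟨⟨rfl, by simp only [gotoRoot, hc, Node.isPath, if_true, List.tail_cons]⟩,
            by simp [r₁], fun F' hF' => ?_⟩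
          simp only [extractPaths_append, Set.eqOn_union] at hF'
          have := hF'.2 (x := path) (by simp [extractPaths])
          beta_reduce
          rw [denNav]
          simp only [hc, x₁ F' hF'.1, ← this, hf, Option.bind_eq_bind, Option.bind_some]
        · cases h
      · cases h
    · split at h
      · rename_i z hz
        split_ifs at h with hb
        cases h
        simp only [Zipper.parent] at hz
        subst hz
        refine ⟨⟨rfl, by simp [gotoRoot, hb]⟩, by simp, fun F' hF' => ?_⟩
        simp [denNav, Zipper.parent, hb]
      · cases h
    · split at h
      · rename_i hc
        cases h
        refine ⟨⟨rfl, by simp [gotoRoot, hc, Node.isPath]⟩, by simp, fun F' hF' => ?_⟩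
        simp [denNav, hc]
      · cases h
    · split at h
      · rename_i hc
        cases h
        refine ⟨⟨rfl, by simp [gotoRoot, hc, Node.isPath]⟩, by simp, fun F' hF' => ?_⟩
        simp [denNav, hc]
      · cases h
    · split at h
      · rename_i hc
        simp only [Option.bind_eq_bind, Option.bind_eq_some_iff] at h
        obtain ⟨⟨a, l⟩, h₁, h⟩ := h
        obtain ⟨r₁, x₁⟩ := hE _ _ _ h₁
        simp only at r₁ x₁ h
        split at h
        · split at h
          · cases h
          · rename_i hs
            cases h
            refine ⟨⟨rfl, by simp [gotoRoot, hc, Node.isPath]⟩, r₁, fun F' hF' => ?_⟩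
            beta_reduce
            rw [denNav]
            simp [hc, x₁ F' hF', hs]
        · cases h
      · cases h
    · split at h
      · rename_i z hz
        split_ifs at h with hb
        cases h
        simp only [Zipper.parent] at hz
        subst hz
        refine ⟨⟨rfl, by simp [gotoRoot, hb]⟩, by simp, fun F' hF' => ?_⟩
        simp [denNav, Zipper.parent, hb]
      · cases h
    · split at h
      · rename_i hz
        cases h
        cases hz
        exact ⟨⟨rfl, by simp [gotoRoot]⟩, by simp, fun F' hF' => by simp [denNav]⟩
      · cases h
    · split at h
      · rename_i hz
        cases h
        cases hz
        exact ⟨⟨rfl, by simp [gotoRoot]⟩, by simp, fun F' hF' => by simp [denNav]⟩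
      · cases h

/-! ### Updates and commands depend only on the paths that they log -/

/-- `Tracks F l x r`: the run `x`, parametrized by the file system, gives the result `r` on every
file system that agrees with `F` on a prefix-closed set of paths that contains those in `l`, and
`l` keeps the root a directory. -/
def Tracks {α : Type} (F : FS) (l : Log) (x : FS → Option α) (r : FS → α) : Prop :=
  (∀ k ∈ l, RootDir k) ∧ ∀ (P : Set Path) (F' : FS), PrefixClosed P → extractPaths l ⊆ P → P.EqOn F F' →
    x F' = some (r F')

theorem Replays.tracks {α : Type} {F : FS} {l : Log} {x : FS → Option α} {r : FS → α}
    (h : Replays F l x r) : Tracks F l x r :=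
  ⟨h.1.rootDir, fun _ F' _ hl hF' => h.2 F' (hF'.mono hl)⟩

theorem addNode_fst (F : FS) (p : Path) (s : String) :
    (addNode F p s).1 = F.merge (addNode F p s).2 := by
  induction p generalizing s with
  | nil =>
    rw [addNode]
    rcases hF : F [] with _ | _ | _
    · simp [FS.merge, FS.update]
    · dsimp only
      split_ifs <;> simp [FS.merge, FS.update]
    · simp [FS.merge, FS.update]
  | cons u p ih =>
    rw [addNode]
    rcases hF : F (u :: p) with _ | _ | _
    · dsimp only
      rw [FS.merge_append, ← ih]
      simp [FS.merge, FS.update]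
    · dsimp only
      split_ifs <;> simp [FS.merge, FS.update]
    · simp [FS.merge, FS.update]

theorem addNode_rootDir (F : FS) (p : Path) (s : String) : ∀ k ∈ (addNode F p s).2, RootDir k := by
  induction p generalizing s with
  | nil =>
    rw [addNode]
    rcases hF : F [] with _ | _ | _
    · simp [RootDir]
    · dsimp only
      split_ifs <;> simp [RootDir]
    · simp [RootDir]
  | cons u p ih =>
    rw [addNode]
    rcases hF : F (u :: p) with _ | _ | _
    · intro k hk
      rcases List.mem_append.1 hk with hk | hk
      · exact ih u k hk
      · rw [List.mem_singleton] at hk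
        simp [hk, RootDir]
    · dsimp only
      split_ifs <;> simp [RootDir]
    · simp [RootDir]

/-- The recursion inspects the original file system only at `p` and its ancestors. Together with
`addNode_fst` this makes the whole result a function of those contents and the merge. -/
theorem addNode_snd_congr {F F' : FS} {p : Path} (h : ∀ q, q <:+ p → F q = F' q) (s : String) :
    (addNode F p s).2 = (addNode F' p s).2 := by
  induction p generalizing s with
  | nil =>
    rw [addNode, addNode, ← h [] List.suffix_rfl]
    rcases F [] with _ | _ | _ <;> dsimp only
    split_ifs <;> rfl
  | cons u p ih =>
    rw [addNode, addNode, ← h (u :: p) List.suffix_rfl]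
    rcases F (u :: p) with _ | _ | _ <;> dsimp only
    · rw [ih fun q hq => h q (hq.trans (List.suffix_cons u p))]
    · split_ifs <;> rfl

theorem addSelf_fst (F : FS) (p : Path) : (addSelf F p).1 = F.merge (addSelf F p).2 := by
  cases p with
  | nil => rfl
  | cons u p => exact addNode_fst F p u

theorem addSelf_rootDir (F : FS) (p : Path) : ∀ k ∈ (addSelf F p).2, RootDir k := by
  cases p with
  | nil => simp [addSelf]
  | cons u p => exact addNode_rootDir F p u

theorem addSelf_snd_congr {F F' : FS} {p : Path} (h : ∀ q, q <:+ p → F q = F' q) :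
    (addSelf F p).2 = (addSelf F' p).2 := by
  cases p with
  | nil => rfl
  | cons u p => exact addNode_snd_congr (fun q hq => h q (hq.trans (List.suffix_cons u p))) u

theorem makeDir_fst (F : FS) (p : Path) (S : Finset String) :
    (makeDir F p S).1 = F.merge (makeDir F p S).2 := by
  simp only [makeDir, FS.merge_append, ← addSelf_fst]
  simp [FS.merge, FS.update]

theorem makeDir_tracks (F : FS) (p : Path) (S : Finset String) :
    Tracks F (makeDir F p S).2 (fun F' => some (makeDir F' p S))
      fun F' => (F'.merge (makeDir F p S).2, (makeDir F p S).2) := by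
  refine ⟨fun k hk => ?_, fun P F' hP hl hF' => ?_⟩
  · rcases List.mem_append.1 hk with hk | hk
    · exact addSelf_rootDir F p k hk
    · rw [List.mem_singleton] at hk
      simp [hk, RootDir]
  · have hp : p ∈ P := hl (by simp [makeDir, extractPaths_append, extractPaths])
    have hlog : (addSelf F p).2 = (addSelf F' p).2 :=
      addSelf_snd_congr fun q hq => hF' (hP p hp q hq)
    -- The logged old contents are those after `addSelf`, so agreement has to be carried through the
    -- merge of its log.
    have hold : (addSelf F p).1 p = (addSelf F' p).1 p := by
      rw [addSelf_fst, addSelf_fst, hlog]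
      exact FS.merge_eqOn hP hF' _ hp
    have : (makeDir F p S).2 = (makeDir F' p S).2 := by simp only [makeDir, hlog, hold]
    beta_reduce
    rw [this, ← makeDir_fst]

theorem makeFile_tracks {F F₁ : FS} {p : Path} {s : String} {l : Log}
    (h : makeFile F p s = some (F₁, l)) : F₁ = F.merge l ∧
      Tracks F l (fun F' => makeFile F' p s) fun F' => (F'.merge l, l) := by
  -- The old contents `c` are arbitrary since merging ignores them.
  have key : ∀ F : FS, ∀ u q c, ((addSelf F (u :: q)).1.set (u :: q) (.file s)).close =
      F.merge ((addSelf F (u :: q)).2 ++ [.writeFile c (.file s) (u :: q)]) := by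
    intro F u q c
    rw [FS.merge_append, ← addSelf_fst]
    rfl
  cases p with
  | nil => cases h
  | cons u q =>
    cases h
    refine ⟨key _ _ _ _, fun k hk => ?_, fun P F' hP hl hF' => ?_⟩
    · rcases List.mem_append.1 hk with hk | hk
      · exact addSelf_rootDir F (u :: q) k hk
      · rw [List.mem_singleton] at hk
        simp [hk, RootDir]
    · have hp : u :: q ∈ P := hl (by simp [extractPaths_append, extractPaths])
      have hlog : (addSelf F (u :: q)).2 = (addSelf F' (u :: q)).2 :=
        addSelf_snd_congr fun r hr => hF' (hP _ hp r hr)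
      have hold : (addSelf F (u :: q)).1 (u :: q) = (addSelf F' (u :: q)).1 (u :: q) := by
        rw [addSelf_fst, addSelf_fst, hlog]
        exact FS.merge_eqOn hP hF' _ hp
      beta_reduce
      rw [hlog, hold, ← key]
      rfl

theorem denUpdate_tracks {prim : Fn → Val Fn → Option (Val Fn)} {w : Update Fn} {C C' : Ctx Fn}
    {G G' : GCtx} {l : Log} (h : denUpdate prim w C G = some (C', G', l)) :
    C' = C ∧ G'.fs = G.fs.merge l ∧
      Tracks G.fs l (fun F => denUpdate prim w C ⟨G.paths, F⟩)
        fun F => (C', ⟨G'.paths, F.merge l⟩, l) := by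
  unfold denUpdate at h
  split at h
  · split at h
    · rename_i hc
      simp only [Option.bind_eq_bind, Option.bind_eq_some_iff] at h
      obtain ⟨⟨a, l₁⟩, h₁, h⟩ := h
      obtain ⟨r₁, x₁⟩ := (den_replays prim G).1 _ _ _ h₁
      dsimp only at r₁ x₁ h
      split at h
      · simp only [Option.bind_eq_some_iff] at h
        obtain ⟨⟨F₂, l₂⟩, h₂, h⟩ := h
        obtain ⟨rfl, r₂, x₂⟩ := makeFile_tracks h₂
        cases h
        refine ⟨rfl, by simp [FS.merge_append, r₁.merge], fun k hk => ?_, fun P F' hP hl hF' => ?_⟩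
        · exact (List.mem_append.1 hk).elim (r₁.rootDir k) (r₂ k)
        · rw [extractPaths_append, Set.union_subset_iff] at hl
          simp [denUpdate, hc, x₁ F' (hF'.mono hl.1), x₂ P F' hP hl.2 hF', FS.merge_append,
            r₁.merge]
      · cases h
    · cases h
  · split at h
    · rename_i hc
      simp only [Option.bind_eq_bind, Option.bind_eq_some_iff] at h
      obtain ⟨⟨a, l₁⟩, h₁, h⟩ := h
      obtain ⟨r₁, x₁⟩ := (den_replays prim G).1 _ _ _ h₁
      dsimp only at r₁ x₁ h
      split at h
      · rename_i S
        obtain ⟨r₂, x₂⟩ := makeDir_tracks G.fs C.path S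
        cases h
        refine ⟨rfl, by simp [FS.merge_append, r₁.merge, makeDir_fst], fun k hk => ?_,
          fun P F' hP hl hF' => ?_⟩
        · exact (List.mem_append.1 hk).elim (r₁.rootDir k) (r₂ k)
        · rw [extractPaths_append, Set.union_subset_iff] at hl
          have h₂ := Option.some.inj (x₂ P F' hP hl.2 hF')
          simp [denUpdate, hc, x₁ F' (hF'.mono hl.1), h₂, FS.merge_append, r₁.merge]
      · cases h
    · cases h
  · split at h
    · rename_i hc
      simp only [Option.bind_eq_bind, Option.bind_eq_some_iff] at h
      obtain ⟨⟨a, l₁⟩, h₁, h⟩ := h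
      obtain ⟨r₁, x₁⟩ := (den_replays prim G).1 _ _ _ h₁
      dsimp only at r₁ x₁ h
      split at h
      · rename_i u
        cases h
        have hr := readOnly_read (G.fs C.path) C.path
        refine ⟨rfl, by rw [FS.merge_append, r₁.merge, FS.merge_append, hr.merge, addNode_fst],
          fun k hk => ?_, fun P F' hP hl hF' => ?_⟩
        · rcases List.mem_append.1 hk with hk | hk
          · exact r₁.rootDir k hk
          · exact (List.mem_append.1 hk).elim (hr.rootDir k) (addNode_rootDir G.fs C.path u k)
        · simp only [extractPaths_append, Set.union_subset_iff] at hl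
          -- The explicit read is what puts the path into `P`: `addNode` logs nothing when the child
          -- is already listed.
          have hp : C.path ∈ P := hl.2.1 (by simp [extractPaths])
          have h₂ : (addNode G.fs C.path u).2 = (addNode F' C.path u).2 :=
            addNode_snd_congr (fun q hq => hF' (hP _ hp q hq)) u
          have h₃ : G.fs C.path = F' C.path := hF' hp
          beta_reduce
          rw [FS.merge_append, r₁.merge, FS.merge_append, hr.merge, h₂, ← addNode_fst]
          simp [denUpdate, hc, x₁ F' (hF'.mono hl.1), h₃]
      · cases h
    · cases h

theorem denFCmd_tracks {prim : Fn → Val Fn → Option (Val Fn)} {f : FCmd Fn} {C C' : Ctx Fn}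
    {G G' : GCtx} {l : Log} (h : denFCmd prim f C G = some (C', G', l)) :
    gotoRoot C'.path C'.zip = gotoRoot C.path C.zip ∧ G'.fs = G.fs.merge l ∧
      Tracks G.fs l (fun F => denFCmd prim f C ⟨G.paths, F⟩)
        fun F => (C', ⟨G'.paths, F.merge l⟩, l) := by
  cases f with
  | nav n =>
    obtain ⟨⟨h₁, h₂⟩, h₃⟩ := (den_replays prim G).2.2.2 _ _ _ h
    refine ⟨h₂, by rw [h₃.1.merge]; exact h₁, ?_⟩
    simp only [h₃.1.merge]
    exact h₃.tracks
  | update w =>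
    obtain ⟨rfl, h⟩ := denUpdate_tracks h
    exact ⟨rfl, h⟩

/-- Fixpoint induction. In a sequence the second command starts on the merge of the first log;
merging one log into two file systems preserves their agreement on the fixed prefix-closed set `P`,
so the second hypothesis applies with the same `P`. -/
theorem denCmd_tracks (prim : Fn → Val Fn → Option (Val Fn)) (c : Cmd Fn) (C : Ctx Fn)
    (G : GCtx) (r : Ctx Fn × GCtx × Log) (h : denCmd prim c C G = some r) :
    r.2.1.fs = G.fs.merge r.2.2 ∧ Tracks G.fs r.2.2 (fun F => denCmd prim c C ⟨G.paths, F⟩)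
      fun F => (r.1, ⟨r.2.1.paths, F.merge r.2.2⟩, r.2.2) := by
  refine denCmd.partial_correctness prim (fun c C G r => r.2.1.fs = G.fs.merge r.2.2 ∧
    Tracks G.fs r.2.2 (fun F => denCmd prim c C ⟨G.paths, F⟩)
      fun F => (r.1, ⟨r.2.1.paths, F.merge r.2.2⟩, r.2.2)) ?_ c C G r h
  clear h r G C c
  intro dC ih c C G r h
  split at h
  · obtain ⟨-, h₁, h₂⟩ := denFCmd_tracks (C' := r.1) (G' := r.2.1) (l := r.2.2) h
    refine ⟨h₁, ?_⟩
    simpa only [denCmd] using h₂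
  · cases h
    simp [Tracks, denCmd]
  · simp only [Option.bind_eq_bind, Option.bind_eq_some_iff] at h
    obtain ⟨⟨C₁, G₁, l₁⟩, h₁, ⟨C₂, G₂, l₂⟩, h₂, h⟩ := h
    obtain ⟨e₁, r₁, x₁⟩ := ih _ _ _ _ h₁
    obtain ⟨e₂, r₂, x₂⟩ := ih _ _ _ _ h₂
    dsimp only at e₁ e₂ r₁ r₂ x₁ x₂
    cases h
    refine ⟨by simp [FS.merge_append, e₁, e₂],
      fun k hk => (List.mem_append.1 hk).elim (r₁ k) (r₂ k), fun P F' hP hl hF' => ?_⟩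
    simp only [extractPaths_append, Set.union_subset_iff] at hl
    have h₂' := x₂ P (F'.merge l₁) hP hl.2 (e₁ ▸ FS.merge_eqOn hP hF' l₁)
    beta_reduce
    rw [denCmd]
    simp [x₁ P F' hP hl.1 hF', h₂', FS.merge_append]
  · simp only [Option.bind_eq_bind, Option.bind_eq_some_iff] at h
    obtain ⟨⟨a, l₁⟩, h₁, h⟩ := h
    obtain ⟨r₁, x₁⟩ := (den_replays prim G).1 _ _ _ h₁
    cases h
    refine ⟨(r₁.merge _).symm, r₁.rootDir, fun P F' hP hl hF' => ?_⟩
    beta_reduce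
    rw [denCmd]
    simp [x₁ F' (hF'.mono hl), r₁.merge]
  · simp only [Option.bind_eq_bind, Option.bind_eq_some_iff] at h
    obtain ⟨⟨a, l₁⟩, h₁, h⟩ := h
    obtain ⟨r₁, x₁⟩ := (den_replays prim G).1 _ _ _ h₁
    dsimp only at r₁ x₁ h
    split at h
    · simp only [Option.bind_eq_some_iff] at h
      obtain ⟨⟨C₂, G₂, l₂⟩, h₂, h⟩ := h
      obtain ⟨e₂, r₂, x₂⟩ := ih _ _ _ _ h₂
      cases h
      refine ⟨by simpa [FS.merge_append, r₁.merge] using e₂,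
        fun k hk => (List.mem_append.1 hk).elim (r₁.rootDir k) (r₂ k), fun P F' hP hl hF' => ?_⟩
      simp only [extractPaths_append, Set.union_subset_iff] at hl
      beta_reduce
      rw [denCmd]
      simp [x₁ F' (hF'.mono hl.1), x₂ P F' hP hl.2 hF', FS.merge_append, r₁.merge]
    · simp only [Option.bind_eq_some_iff] at h
      obtain ⟨⟨C₂, G₂, l₂⟩, h₂, h⟩ := h
      obtain ⟨e₂, r₂, x₂⟩ := ih _ _ _ _ h₂
      cases h
      refine ⟨by simpa [FS.merge_append, r₁.merge] using e₂,
        fun k hk => (List.mem_append.1 hk).elim (r₁.rootDir k) (r₂ k), fun P F' hP hl hF' => ?_⟩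
      simp only [extractPaths_append, Set.union_subset_iff] at hl
      beta_reduce
      rw [denCmd]
      simp [x₁ F' (hF'.mono hl.1), x₂ P F' hP hl.2 hF', FS.merge_append, r₁.merge]
    · cases h
  · simp only [Option.bind_eq_bind, Option.bind_eq_some_iff] at h
    obtain ⟨⟨a, l₀⟩, h₀, h⟩ := h
    obtain ⟨r₀, x₀⟩ := (den_replays prim G).1 _ _ _ h₀
    dsimp only at r₀ x₀ h
    split at h
    · simp only [Option.bind_eq_some_iff] at h
      obtain ⟨⟨C₁, G₁, l₁⟩, h₁, ⟨C₂, G₂, l₂⟩, h₂, h⟩ := h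
      obtain ⟨e₁, r₁, x₁⟩ := ih _ _ _ _ h₁
      obtain ⟨e₂, r₂, x₂⟩ := ih _ _ _ _ h₂
      dsimp only at e₁ e₂ r₁ r₂ x₁ x₂
      cases h
      refine ⟨by simp only [FS.merge_append, r₀.merge, e₁, e₂], fun k hk => ?_,
        fun P F' hP hl hF' => ?_⟩
      · rcases List.mem_append.1 hk with hk | hk
        · exact (List.mem_append.1 hk).elim (r₀.rootDir k) (r₁ k)
        · exact r₂ k hk
      · simp only [extractPaths_append, Set.union_subset_iff] at hl
        have h₂' := x₂ P (F'.merge l₁) hP hl.2 (e₁ ▸ FS.merge_eqOn hP hF' l₁)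
        beta_reduce
        rw [denCmd]
        simp [x₀ F' (hF'.mono hl.1.1), x₁ P F' hP hl.1.2 hF', h₂', FS.merge_append, r₀.merge]
    · cases h
      refine ⟨(r₀.merge _).symm, r₀.rootDir, fun P F' hP hl hF' => ?_⟩
      beta_reduce
      rw [denCmd]
      simp [x₀ F' (hF'.mono hl), r₀.merge]
    · cases h

/-! ### Local steps -/

/-- Only this half of the agreement between small steps and denotation is needed: a step can be
prepended to a remainder that is known to have a value, so termination is never assumed. -/
theorem denCmd_of_localStep {prim : Fn → Val Fn → Option (Val Fn)}
    {X X' : Ctx Fn × GCtx × Cmd Fn} {l : Log} (h : LocalStep prim X l X')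
    {C : Ctx Fn} {G : GCtx} {l' : Log} (h' : denCmd prim X'.2.2 X'.1 X'.2.1 = some (C, G, l')) :
    denCmd prim X.2.2 X.1 X.2.1 = some (C, G, l ++ l') := by
  induction h generalizing C G l' with
  | forest h =>
    rw [denCmd] at h'
    cases h'
    rw [denCmd]
    simpa using h
  | assign h =>
    rw [denCmd] at h'
    cases h'
    rw [denCmd]
    simp [h]
  | seqSkip =>
    rw [denCmd]
    simp [denCmd, h']
  | seqStep h ih =>
    rw [denCmd] at h'
    simp only [Option.bind_eq_bind, Option.bind_eq_some_iff] at h'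
    obtain ⟨⟨C₁, G₁, l₁⟩, h₁, ⟨C₂, G₂, l₂⟩, h₂, h'⟩ := h'
    cases h'
    have h₁' := ih h₁
    dsimp only at h₁' h₂
    rw [denCmd]
    simp [h₁', h₂]
  | iteTrue h =>
    dsimp only at h'
    rw [denCmd]
    simp [h, h']
  | iteFalse h =>
    dsimp only at h'
    rw [denCmd]
    simp [h, h']
  | loop =>
    dsimp only at h'
    rw [denCmd] at h'
    simp only [Option.bind_eq_bind, Option.bind_eq_some_iff] at h'
    obtain ⟨⟨a, l₁⟩, h₁, h'⟩ := h'
    dsimp only at h'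
    split at h'
    · simp only [Option.bind_eq_some_iff] at h'
      obtain ⟨⟨C₁, G₁, l₂⟩, h₂, h'⟩ := h'
      cases h'
      rw [denCmd] at h₂
      simp only [Option.bind_eq_bind, Option.bind_eq_some_iff] at h₂
      obtain ⟨⟨C₁, G₁, l₁⟩, h₂, ⟨C₂, G₂, l₂⟩, h₃, h'⟩ := h₂
      cases h'
      dsimp only at h₃
      rw [denCmd]
      simp [h₁, h₂, h₃]
    · rw [denCmd] at h'
      cases h'
      rw [denCmd]
      simp [h₁]
    · cases h'

theorem LocalStep.gotoRoot_eq {prim : Fn → Val Fn → Option (Val Fn)}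
    {X X' : Ctx Fn × GCtx × Cmd Fn} {l : Log} (h : LocalStep prim X l X') :
    gotoRoot X'.1.path X'.1.zip = gotoRoot X.1.path X.1.zip := by
  induction h with
  | forest h => exact (denFCmd_tracks h).1
  | seqStep h ih => exact ih
  | assign | seqSkip | iteTrue | iteFalse | loop => rfl

/-! ### Serializability -/

/-- The paths at which the writes in a global log from time `τ` on have no effect. -/
def unaffected [LinearOrder Time] (K : GLog Time) (τ : Time) : Set Path :=
  {p | ∀ k ∈ K, k.1 < τ ∨ ¬ ConflictPath p k.2}

/-- A write at or above a prefix of `p` is also at or above `p`. -/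
theorem prefixClosed_unaffected [LinearOrder Time] (K : GLog Time) (τ : Time) :
    PrefixClosed (unaffected K τ) := by
  intro p hp q hq k hk
  refine (hp k hk).imp_right fun h hc => h ?_
  obtain ⟨τ', k⟩ := k
  cases k with
  | read c r => exact hc
  | writeFile c c' r => exact List.IsSuffix.trans hc hq
  | writeDir c c' r => exact List.IsSuffix.trans hc hq

/-- `t` is a run of `t₀` in progress: it started on some file system `Fs` that agrees with the
present one where no later commit has written, it can still be moved back to where it started, and
whatever its remaining command computes, `t₀` computes on `Fs`. -/
def Runs [LinearOrder Time] (prim : Fn → Val Fn → Option (Val Fn)) (F : FS) (K : GLog Time)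
    (t₀ t : Transaction Fn Time) : Prop :=
  ∃ (F₀ Fs : FS) (p : Path) (z : Zipper Fn) (τ : Time),
    t₀ = startTransaction F₀ p z t.cmd τ ∧ z.parent = none ∧
    gotoRoot t.thread.path t.thread.zip = (p, z) ∧
    (unaffected K t.start).EqOn Fs F ∧
    ∀ C G l, denCmd prim t.thread.cmd ⟨t.thread.env, t.thread.path, t.thread.zip⟩
        ⟨t.thread.paths, t.thread.fs⟩ = some (C, G, l) →
      denCmd prim t.cmd ⟨fun _ => none, p, z⟩ ⟨∅, Fs⟩ = some (C, G, t.log ++ l)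

theorem gotoRoot_of_parent_eq_none (p : Path) {z : Zipper Fn} (h : z.parent = none) :
    gotoRoot p z = (p, z) := by
  obtain ⟨_, l, c, r⟩ := z
  cases h
  rw [gotoRoot]

theorem runs_startTransaction [LinearOrder Time] (prim : Fn → Val Fn → Option (Val Fn))
    (F₀ F : FS) (K : GLog Time) (p : Path) {z : Zipper Fn} (hz : z.parent = none) (c : Cmd Fn)
    (τ τ' : Time) : Runs prim F K (startTransaction F₀ p z c τ) (startTransaction F p z c τ') :=
  ⟨F₀, F, p, z, τ, rfl, hz, gotoRoot_of_parent_eq_none p hz, fun _ _ => rfl, fun _ _ _ h => h⟩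

/-- A transaction that commits has the effect that it would have on the present file system. -/
theorem Runs.denTransaction [LinearOrder Time] {prim : Fn → Val Fn → Option (Val Fn)} {F : FS}
    {K : GLog Time} {t₀ t : Transaction Fn Time} (h : Runs prim F K t₀ t)
    (ht : t.thread.IsDone) (hc : CheckLog K t.start t.log) :
    denTransaction prim F t₀ = some (F.merge t.log) ∧ ∀ k ∈ t.log, RootDir k := by
  obtain ⟨F₀, Fs, p, z, τ, rfl, -, -, hF, h⟩ := h
  have h := h _ _ _ (by rw [ht, denCmd])
  rw [List.append_nil] at h
  obtain ⟨-, h₁, h₂⟩ := denCmd_tracks prim _ _ _ _ h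
  -- `CheckLog` unfolds to the inclusion of the logged paths in the unaffected set.
  have := h₂ _ F (prefixClosed_unaffected K t.start) hc hF
  dsimp only at this
  exact ⟨by simp [TxForest.denTransaction, startTransaction, this], h₁⟩

/-- Another transaction's commit leaves the witness `Fs` as it is. A path still unaffected
afterwards avoids the new writes, so the present file system has not changed there. -/
theorem Runs.commit [LinearOrder Time] {prim : Fn → Val Fn → Option (Val Fn)} {F : FS}
    (hF : F.WellFormed) {K : GLog Time} {t₀ t : Transaction Fn Time} (h : Runs prim F K t₀ t)
    {l : Log} (hl : ∀ k ∈ l, RootDir k) {τ' : Time} (hτ : t.start < τ') :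
    Runs prim (F.merge l) (K ++ addTimestamp τ' l) t₀ t := by
  obtain ⟨F₀, Fs, p, z, τ, h₀, hz, hroot, hFs, h⟩ := h
  refine ⟨F₀, Fs, p, z, τ, h₀, hz, hroot, fun q hq => ?_, h⟩
  rw [hF.merge_apply hl fun k hk => ?_]
  · exact hFs fun k hk => hq k (List.mem_append_left _ hk)
  -- The new entries are later than the start of `t`, so being unaffected can only mean not
  -- conflicting.
  · exact (hq (τ', k) (List.mem_append_right _ (List.mem_map.2 ⟨k, hk, rfl⟩))).resolve_left
      (not_lt_of_gt hτ)

/-- Induction from the first step on, with `T` the original transactions of those still in the pool.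
A commit puts its original at the head of the list, and well-formedness survives since the log keeps
the root a directory. -/
theorem exists_serial_of_reflTransGen [LinearOrder Time] {prim : Fn → Val Fn → Option (Val Fn)}
    {S S' : Config Fn Time} (h : Relation.ReflTransGen (GlobalStep prim) S S')
    (hS' : S'.pool = 0) {T : Multiset (Transaction Fn Time)} (hS : S.fs.WellFormed)
    (hT : Multiset.Rel (Runs prim S.fs S.glog) T S.pool) :
    ∃ L : List (Transaction Fn Time), (L : Multiset (Transaction Fn Time)) = T ∧
      denSerial prim L S.fs = some S'.fs := by
  induction h using Relation.ReflTransGen.head_induction_on generalizing T with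
  | refl =>
    rw [hS', Multiset.rel_zero_right] at hT
    exact ⟨[], hT.symm, rfl⟩
  | head hstep _ ih =>
    cases hstep with
    | run hs =>
      obtain ⟨t₀, T₀, ⟨F₀, Fs, p, z, τ, h₀, hz, hroot, hFs, h⟩, hT₀, rfl⟩ :=
        Multiset.rel_cons_right.1 hT
      refine ih hS (hT₀.cons ⟨F₀, Fs, p, z, τ, h₀, hz, hs.gotoRoot_eq.trans hroot, hFs,
        fun C G l h' => ?_⟩)
      rw [List.append_assoc]
      exact h _ _ _ (denCmd_of_localStep hs h')
    | commit ht hc hτ =>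
      obtain ⟨t₀, T₀, h₀, hT₀, rfl⟩ := Multiset.rel_cons_right.1 hT
      obtain ⟨hden, hl⟩ := h₀.denTransaction ht hc
      obtain ⟨L, rfl, hL⟩ := ih (T := T₀) (hS.merge hl) (hT₀.mono fun t₁ _ t ht h =>
        h.commit hS hl (hτ.2 t (Multiset.mem_cons_of_mem ht)))
      refine ⟨t₀ :: L, rfl, ?_⟩
      rw [denSerial, List.foldlM_cons, hden]
      exact hL
    | restart ht hc hτ =>
      obtain ⟨t₀, T₀, ⟨F₀, Fs, p, z, τ, rfl, hz, hroot, -, -⟩, hT₀, rfl⟩ :=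
        Multiset.rel_cons_right.1 hT
      refine ih hS (hT₀.cons ?_)
      dsimp only at hroot
      -- The restarted transaction has the original path and zipper, so it is still paired with
      -- `t₀`, whose own file system and start time do not enter its denotation.
      rw [hroot]
      exact runs_startTransaction prim F₀ _ _ p hz _ _ _

end TxForest

open TxForest in
theorem theorem4 {Fn : Type} {Time : Type*} [LinearOrder Time]
    (prim : Fn → Val Fn → Option (Val Fn))
    (F F' : FS) (hF : F.WellFormed) (K K' : GLog Time)
    (T : Multiset (Transaction Fn Time)) (hT : ∀ t ∈ T, Initial F t)
    (h : Relation.ReflTransGen (GlobalStep prim) ⟨F, K, T⟩ ⟨F', K', 0⟩) :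
    ∃ L : List (Transaction Fn Time), (L : Multiset (Transaction Fn Time)) = T ∧
      denSerial prim L F = some F' := by
  refine exists_serial_of_reflTransGen h rfl hF
    (Multiset.rel_refl_of_refl_on fun t ht => ?_)
  obtain ⟨p, z, c, τ, hz, rfl⟩ := hT t ht
  exact runs_startTransaction prim F F K p hz c τ τ
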